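/- Let $G=(V,E\cup A)$ be a finite mixed graph with undirected edges $E$ and directed arcs $A$; loops are not allowed, but parallel edges and arcs are. An edge covers both of its endpoints, and an arc covers only its head. A matching forest is a set $F\subseteq E\cup A$ whose underlying undirected graph contains no cycle (two members of $F$ with the same pair of endpoints form a cycle) and which covers every vertex at most once. Suppose that $E\cup A$ can be partitioned into $k$ matching forests (parts may be empty). Then $E\cup A$ can be partitioned into $k$ matching forests $F_1,\dots,F_k$ such that, with $M_i=F_i\cap E$ and $B_i=F_i\cap A$, for all $i,j\in\{1,\dots,k\}$ $$\bigl||F_i|-|F_j|\bigr|\le 1,\qquad \bigl||M_i|-|M_j|\bigr|\le 2,\qquad \bigl||B_i|-|B_j|\bigr|\le 2 .$$ -/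

import Mathlib

/-- A mixed graph with vertex set `V`, set of (undirected) edges `E` and set of (directed) arcs `A`.
There are no loops; parallel edges and arcs are allowed. -/
structure MixedGraph (V : Type*) (E : Type*) (A : Type*) where
  /-- the unordered pair of endpoints of an edge -/
  ends : E → Sym2 V
  /-- the tail of an arc -/
  tail : A → V
  /-- the head of an arc -/
  head : A → V
  ends_not_isDiag : ∀ e, ¬ (ends e).IsDiag
  tail_ne_head : ∀ a, tail a ≠ head a

namespace MixedGraph

variable {V E A : Type*}

/-- The unordered pair of endpoints of an edge or arc, that is, its incidence in the underlying
undirected (multi)graph. -/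
def link (G : MixedGraph V E A) : E ⊕ A → Sym2 V
  | Sum.inl e => G.ends e
  | Sum.inr a => s(G.tail a, G.head a)

/-- `v` is covered by the edge or arc `x`, that is, `v` is a head of `x`: both endpoints of an edge
are heads of it, and an arc has exactly one head. -/
def Covers (G : MixedGraph V E A) : E ⊕ A → V → Prop
  | Sum.inl e, v => v ∈ G.ends e
  | Sum.inr a, v => v = G.head a

/-- The underlying undirected multigraph of `F` contains a cycle: there are `m = n + 2 ≥ 2` distinct
vertices `v 0, …, v (m - 1)` and `m` distinct members `x 0, …, x (m - 1)` of `F` such that `x i`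
joins `v i` and `v (i + 1)`, with indices modulo `m`. (Two parallel or antiparallel members of `F`
form a cycle of length two; cycles of length one do not exist because there are no loops.) -/
def HasCycle (G : MixedGraph V E A) (F : Set (E ⊕ A)) : Prop :=
  ∃ (n : ℕ) (v : Fin (n + 2) → V) (x : Fin (n + 2) → E ⊕ A),
    Function.Injective v ∧ Function.Injective x ∧
      ∀ i, x i ∈ F ∧ G.link (x i) = s(v i, v (i + 1))

/-- A matching forest: a set of edges and arcs whose underlying undirected graph has no cycle and
which covers every vertex at most once. -/
def IsMatchingForest (G : MixedGraph V E A) (F : Set (E ⊕ A)) : Prop :=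
  ¬ G.HasCycle F ∧
    ∀ v, ∀ x ∈ F, ∀ y ∈ F, G.Covers x v → G.Covers y v → x = y

/-- `F 0, …, F (k - 1)` are matching forests that partition the set of all edges and arcs.
Members of the partition may be empty. -/
def IsMatchingForestPartition (G : MixedGraph V E A) {k : ℕ} (F : Fin k → Set (E ⊕ A)) : Prop :=
  (∀ i, G.IsMatchingForest (F i)) ∧ ∀ x, ∃! i, x ∈ F i

end MixedGraph

/-- The edge part of a set of edges and arcs. -/
def edgePart {E A : Type*} (F : Set (E ⊕ A)) : Set E := {e | Sum.inl e ∈ F}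

/-- The arc part of a set of edges and arcs. -/
def arcPart {E A : Type*} (F : Set (E ⊕ A)) : Set A := {a | Sum.inr a ∈ F}

/-!
It suffices to balance two disjoint matching forests (`exists_balanced_repartition`): a partition
that minimizes the sum of `2 |F i|² + |M i|² + |B i|²` is then balanced, since balancing an
unbalanced pair of parts would decrease the sum (`quadraticForm_lt`).

A set that covers every vertex at most once is a matching forest if and only if its arcs form no
directed cycle. So a matching forest consists of a matching and a branching whose root set `R`
contains the set `S` of vertices covered by the matching, and it has `|S| / 2` edges and `|V| - |R|`
arcs. Given two of them, when can the roles of the two be exchanged on a set `X` of vertices? The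
matchings only require that no edge joins `X` to its complement. By Edmonds' disjoint branchings
theorem (`CutCondition.exists_branchings`), the arcs can be split into branchings with the new root
sets if both of these meet each minimal nonempty vertex set without entering arcs. Such minimal sets
are disjoint, and each of them contains a common root or a root of either branching alone; choosing
one pair of such roots in each of the latter sets, it is enough that `X` separates no pair
(`CutCondition.exists_pairing`).

The edges of the two matchings and the chosen pairs form a graph of maximum degree two, and `X` may
be any union of its components. A component contributes some `m` to the difference of the edge
numbers and some `f` to the difference of the total sizes, and exchanging the roles on it changes
the signs of both. Counting at the vertices, only those of degree less than two matter, and a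
connected graph has few of these, which gives `m, f ∈ {-1, 0, 1}` (`component_sums_le`). Finally,
vectors of this kind can be signed so that their sum is small in the required sense
(`exists_balanced_signs`).
-/

/-! ### Disjoint branchings with prescribed roots -/

section Branching

variable {V A ι : Type*} [DecidableEq V]

/-- The arcs of `D` that enter the vertex set `U`. -/
def entering (tail head : A → V) (D : Finset A) (U : Finset V) : Finset A :=
  {a ∈ D | head a ∈ U ∧ tail a ∉ U}

/-- The number of root sets `R i` that miss `U`: each branching rooted in such an `R i` needs an arc
that enters `U`. -/
def demand [Fintype ι] (R : ι → Finset V) (U : Finset V) : ℕ :=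
  (Finset.univ.filter fun i => Disjoint (R i) U).card

/-- The cut condition of Edmonds' disjoint branchings theorem for the arc set `D` and the root sets
`R i`. -/
def CutCondition [Fintype ι] (tail head : A → V) (D : Finset A) (R : ι → Finset V) : Prop :=
  ∀ U : Finset V, U.Nonempty → demand R U ≤ (entering tail head D U).card

/-- `B` is a branching with root set `R`: exactly the vertices outside `R` are entered by a member
of `B`, each of them by just one, and `B` has no directed cycle. Acyclicity is encoded by a rank
function on the vertices that increases along the arcs of `B`. -/
structure IsBranching (tail head : A → V) (B : Finset A) (R : Finset V) : Prop where
  head_notMem : ∀ a ∈ B, head a ∉ R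
  exists_head : ∀ v ∉ R, ∃ a ∈ B, head a = v
  head_inj : ∀ a ∈ B, ∀ b ∈ B, head a = head b → a = b
  exists_rank : ∃ ρ : V → ℕ, ∀ a ∈ B, ρ (tail a) < ρ (head a)

variable {tail head : A → V}

lemma mem_entering {D : Finset A} {U : Finset V} {a : A} :
    a ∈ entering tail head D U ↔ a ∈ D ∧ head a ∈ U ∧ tail a ∉ U := by
  simp [entering]

lemma card_entering_inter_add_union_le (D : Finset A) (U W : Finset V) :
    (entering tail head D (U ∩ W)).card + (entering tail head D (U ∪ W)).card ≤
      (entering tail head D U).card + (entering tail head D W).card := by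
  simp only [entering, Finset.card_filter]
  rw [← Finset.sum_add_distrib, ← Finset.sum_add_distrib]
  refine Finset.sum_le_sum fun a _ => ?_
  by_cases h1 : head a ∈ U <;> by_cases h2 : head a ∈ W <;> by_cases h3 : tail a ∈ U <;>
    by_cases h4 : tail a ∈ W <;> simp [h1, h2, h3, h4]

lemma demand_indicator_supermodular (R U W : Finset V) :
    (if Disjoint R U then 1 else 0) + (if Disjoint R W then 1 else 0) ≤
      (if Disjoint R (U ∩ W) then 1 else 0) + (if Disjoint R (U ∪ W) then 1 else 0) := by
  by_cases h1 : Disjoint R U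
  · have h3 : Disjoint R (U ∩ W) := h1.mono_right Finset.inter_subset_left
    by_cases h2 : Disjoint R W <;> simp [h1, h2, h3]
  · by_cases h2 : Disjoint R W
    · have h3 : Disjoint R (U ∩ W) := h2.mono_right Finset.inter_subset_right
      simp [h1, h2, h3]
    · simp [h1, h2]

lemma demand_add_le [Fintype ι] (R : ι → Finset V) (U W : Finset V) :
    demand R U + demand R W ≤ demand R (U ∩ W) + demand R (U ∪ W) := by
  simp only [demand, Finset.card_filter]
  rw [← Finset.sum_add_distrib, ← Finset.sum_add_distrib]
  exact Finset.sum_le_sum fun i _ => demand_indicator_supermodular (R i) U W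

lemma demand_add_lt [Fintype ι] (R : ι → Finset V) (U W : Finset V) (i : ι)
    (hU : ¬ Disjoint (R i) U) (hW : ¬ Disjoint (R i) W) (hUW : Disjoint (R i) (U ∩ W)) :
    demand R U + demand R W < demand R (U ∩ W) + demand R (U ∪ W) := by
  simp only [demand, Finset.card_filter]
  rw [← Finset.sum_add_distrib, ← Finset.sum_add_distrib]
  refine Finset.sum_lt_sum (fun i _ => demand_indicator_supermodular (R i) U W)
    ⟨i, Finset.mem_univ i, ?_⟩
  simp [hU, hW, hUW]

/-- The augmentation step of Lovász's proof of Edmonds' theorem: as long as `R i` is not everything,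
some arc leaving `R i` can be given to the `i`-th branching. -/
lemma CutCondition.exists_arc [Fintype V] [Fintype ι] [DecidableEq ι] [DecidableEq A]
    {D : Finset A} {R : ι → Finset V} (h : CutCondition tail head D R) {i : ι} {w : V}
    (hw : w ∉ R i) :
    ∃ a ∈ D, tail a ∈ R i ∧ head a ∉ R i ∧
      CutCondition tail head (D.erase a) (Function.update R i (insert (head a) (R i))) := by
  have huniv : entering tail head D Finset.univ = ∅ := by simp [entering]
  have hd : demand R Finset.univ = 0 := by
    have := h Finset.univ ⟨w, Finset.mem_univ w⟩
    rw [huniv] at this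
    simpa using this
  have hRi : ¬ Disjoint (R i) Finset.univ := by
    intro hdis
    rw [demand, Finset.card_eq_zero, Finset.filter_eq_empty_iff] at hd
    exact hd (Finset.mem_univ i) hdis
  -- `W` is a minimal tight set that meets both `R i` and its complement
  obtain ⟨W, -, hWmin⟩ := exists_minimal_le_of_wellFoundedLT
    (fun W : Finset V => ¬ Disjoint (R i) W ∧ (∃ v ∈ W, v ∉ R i) ∧
      (entering tail head D W).card = demand R W) Finset.univ
    ⟨hRi, ⟨w, Finset.mem_univ w, hw⟩, by rw [huniv, hd]; rfl⟩
  obtain ⟨hW1, ⟨v, hvW, hvR⟩, hW3⟩ := hWmin.prop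
  have hlt : demand R W < demand R (W \ R i) := by
    refine Finset.card_lt_card (Finset.ssubset_iff_of_subset ?_ |>.2 ⟨i, ?_, ?_⟩)
    · intro j hj
      simp only [Finset.mem_filter, Finset.mem_univ, true_and] at hj ⊢
      exact hj.mono_right Finset.sdiff_subset
    · simpa using Finset.disjoint_sdiff
    · simpa using hW1
  have hge := h (W \ R i) ⟨v, by simp [hvW, hvR]⟩
  obtain ⟨a, ha1, ha2⟩ : ∃ a ∈ entering tail head D (W \ R i), a ∉ entering tail head D W := by
    by_contra! hcon
    have hsub : entering tail head D (W \ R i) ⊆ entering tail head D W := hcon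
    have := Finset.card_le_card hsub
    omega
  rw [mem_entering, Finset.mem_sdiff, Finset.mem_sdiff] at ha1
  obtain ⟨haD, ⟨hhW, hhR⟩, ht⟩ := ha1
  have htW : tail a ∈ W := by
    by_contra hcon
    exact ha2 (mem_entering.2 ⟨haD, hhW, hcon⟩)
  have htR : tail a ∈ R i := by
    by_contra hcon
    exact ht ⟨htW, hcon⟩
  refine ⟨a, haD, htR, hhR, fun U hU => ?_⟩
  by_contra! hviol
  have hle : demand (Function.update R i (insert (head a) (R i))) U ≤ demand R U := by
    refine Finset.card_le_card fun j hj => ?_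
    simp only [Finset.mem_filter, Finset.mem_univ, true_and] at hj ⊢
    by_cases hji : j = i
    · subst hji
      rw [Function.update_self] at hj
      exact hj.mono_left (Finset.subset_insert _ _)
    · rwa [Function.update_of_ne hji] at hj
  have herase : entering tail head (D.erase a) U = (entering tail head D U).erase a := by
    ext b
    simp only [mem_entering, Finset.mem_erase]
    tauto
  rw [herase] at hviol
  have hUge := h U hU
  have haU : a ∈ entering tail head D U := by
    by_contra hcon
    rw [Finset.erase_eq_of_notMem hcon] at hviol
    omega
  rw [Finset.card_erase_of_mem haU] at hviol
  have hpos : 0 < (entering tail head D U).card := Finset.card_pos.2 ⟨a, haU⟩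
  obtain ⟨-, hhU, htU⟩ := mem_entering.1 haU
  have hUR : ¬ Disjoint (R i) U := by
    intro hdis
    have : demand (Function.update R i (insert (head a) (R i))) U < demand R U := by
      refine Finset.card_lt_card (Finset.ssubset_iff_of_subset ?_ |>.2 ⟨i, ?_, ?_⟩)
      · intro j hj
        simp only [Finset.mem_filter, Finset.mem_univ, true_and] at hj ⊢
        by_cases hji : j = i
        · subst hji
          exact hdis
        · rwa [Function.update_of_ne hji] at hj
      · simpa using hdis
      · simp [hhU]
    omega
  -- a violating `U` would make `U ∩ W` a smaller tight set
  have hsub := card_entering_inter_add_union_le (tail := tail) (head := head) D U W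
  have hsup := demand_add_le R U W
  have h1 := h (U ∩ W) ⟨head a, by simp [hhU, hhW]⟩
  have h2 := h (U ∪ W) ⟨head a, by simp [hhU]⟩
  have hint : ¬ Disjoint (R i) (U ∩ W) := fun hdis => by
    have := demand_add_lt R U W i hUR hW1 hdis
    omega
  have hWU : W ≤ U ∩ W := hWmin.le_of_le
    ⟨hint, ⟨head a, by simp [hhU, hhW], hhR⟩, by omega⟩ Finset.inter_subset_right
  exact htU (Finset.mem_inter.1 (hWU htW)).1

/-- **Edmonds' disjoint branchings theorem**. -/
theorem CutCondition.exists_branchings [Fintype V] [Fintype ι] [DecidableEq ι] [DecidableEq A]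
    {D : Finset A} {R : ι → Finset V} (h : CutCondition tail head D R) :
    ∃ B : ι → Finset A, (∀ i, B i ⊆ D) ∧ (∀ i j, i ≠ j → Disjoint (B i) (B j)) ∧
      ∀ i, IsBranching tail head (B i) (R i) := by
  induction hn : ∑ i, (R i)ᶜ.card generalizing D R with
  | zero =>
    have hR : ∀ i v, v ∈ R i := by
      intro i v
      have := (Finset.sum_eq_zero_iff.1 hn) i (Finset.mem_univ i)
      simpa using Finset.eq_empty_iff_forall_notMem.1 (Finset.card_eq_zero.1 this) v
    exact ⟨fun _ => ∅, by simp, by simp, fun i => ⟨by simp, fun v hv => absurd (hR i v) hv,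
      by simp, ⟨fun _ => 0, by simp⟩⟩⟩
  | succ n ih =>
    obtain ⟨i, hi⟩ : ∃ i, (R i)ᶜ.card ≠ 0 := by
      by_contra! hcon
      simp [hcon] at hn
    obtain ⟨w, hw⟩ := Finset.card_pos.1 (Nat.pos_of_ne_zero hi)
    obtain ⟨a, haD, hta, hha, hcut⟩ := h.exists_arc (Finset.mem_compl.1 hw)
    have hsum : ∑ j, (Function.update R i (insert (head a) (R i)) j)ᶜ.card = n := by
      rw [← Finset.add_sum_erase _ _ (Finset.mem_univ i)] at hn ⊢
      have h1 : ∀ j ∈ Finset.univ.erase i,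
          (Function.update R i (insert (head a) (R i)) j)ᶜ.card = (R j)ᶜ.card := by
        intro j hj
        rw [Function.update_of_ne (Finset.ne_of_mem_erase hj)]
      rw [Finset.sum_congr rfl h1, Function.update_self, Finset.compl_insert,
        Finset.card_erase_of_mem (Finset.mem_compl.2 hha)]
      have : 0 < (R i)ᶜ.card := Nat.pos_of_ne_zero hi
      omega
    obtain ⟨B, hBD, hdisj, hB⟩ := ih hcut hsum
    have haB : ∀ j, a ∉ B j := fun j hj => Finset.notMem_erase a D (hBD j hj)
    refine ⟨Function.update B i (insert a (B i)), ?_, ?_, ?_⟩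
    · intro j
      by_cases hj : j = i
      · subst hj
        rw [Function.update_self]
        exact Finset.insert_subset haD ((hBD j).trans (Finset.erase_subset _ _))
      · rw [Function.update_of_ne hj]
        exact (hBD j).trans (Finset.erase_subset _ _)
    · intro j l hjl
      by_cases hj : j = i
      · subst hj
        rw [Function.update_self, Function.update_of_ne hjl.symm, Finset.disjoint_insert_left]
        exact ⟨haB l, hdisj j l hjl⟩
      · by_cases hl : l = i
        · subst hl
          rw [Function.update_self, Function.update_of_ne hj, Finset.disjoint_insert_right]
          exact ⟨haB j, hdisj j l hjl⟩
        · rw [Function.update_of_ne hj, Function.update_of_ne hl]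
          exact hdisj j l hjl
    · intro j
      by_cases hj : j = i
      · subst hj
        have hBj := hB j
        rw [Function.update_self] at hBj ⊢
        obtain ⟨ρ, hρ⟩ := hBj.exists_rank
        refine ⟨?_, ?_, ?_, ⟨fun v => if v ∈ R j then 0 else ρ v + 1, ?_⟩⟩
        · intro b hb
          rcases Finset.mem_insert.1 hb with rfl | hb
          · exact hha
          · exact fun hc => hBj.head_notMem b hb (Finset.mem_insert_of_mem hc)
        · intro v hv
          by_cases hva : v = head a
          · exact ⟨a, Finset.mem_insert_self _ _, hva.symm⟩
          · obtain ⟨b, hb, hbv⟩ := hBj.exists_head v (by simp [hva, hv])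
            exact ⟨b, Finset.mem_insert_of_mem hb, hbv⟩
        · have key : ∀ b ∈ B j, head b ≠ head a := fun b hb hc =>
            hBj.head_notMem b hb (by simp [hc])
          intro b hb c hc hbc
          rcases Finset.mem_insert.1 hb with hb | hb <;> rcases Finset.mem_insert.1 hc with hc | hc
          · rw [hb, hc]
          · exact absurd (by rw [← hbc, hb]) (key c hc)
          · exact absurd (by rw [hbc, hc]) (key b hb)
          · exact hBj.head_inj b hb c hc hbc
        · intro b hb
          rcases Finset.mem_insert.1 hb with rfl | hb
          · simp [hta, hha]
          · have h1 : head b ∉ R j := fun hc =>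
              hBj.head_notMem b hb (Finset.mem_insert_of_mem hc)
            have h2 := hρ b hb
            simp only [h1, if_false]
            split_ifs <;> omega
      · have hBj := hB j
        rwa [Function.update_of_ne hj] at hBj ⊢

end Branching

/-! ### Matching forests and branchings -/

namespace MixedGraph

variable {V E A : Type*} (G : MixedGraph V E A)

lemma covers_or_covers_of_link {x : E ⊕ A} {u w : V} (h : G.link x = s(u, w)) :
    G.Covers x u ∨ G.Covers x w := by
  rcases x with e | a
  · left
    change u ∈ G.ends e
    rw [show G.ends e = s(u, w) from h]
    exact Sym2.mem_mk_left u w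
  · have : G.head a ∈ s(u, w) := by
      rw [← h]
      exact Sym2.mem_mk_right _ _
    rcases Sym2.mem_iff.1 this with h | h
    · exact Or.inl h.symm
    · exact Or.inr h.symm

/-- On a cycle of a set that covers every vertex at most once, each member covers exactly one
vertex of the cycle, so the cycle is a directed one, and a rank function excludes it. -/
lemma not_hasCycle_of_rank {F : Set (E ⊕ A)}
    (hcov : ∀ v, ∀ x ∈ F, ∀ y ∈ F, G.Covers x v → G.Covers y v → x = y) (ρ : V → ℕ)
    (hρ : ∀ a, Sum.inr a ∈ F → ρ (G.tail a) < ρ (G.head a)) : ¬ G.HasCycle F := by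
  rintro ⟨n, v, x, -, hx, hF⟩
  have hex : ∀ i, ∃ j, G.Covers (x i) (v j) := by
    intro i
    rcases G.covers_or_covers_of_link (hF i).2 with h | h
    · exact ⟨_, h⟩
    · exact ⟨_, h⟩
  choose φ hφ using hex
  have hinj : Function.Injective φ := by
    intro i j hij
    refine hx (hcov (v (φ i)) _ (hF i).1 _ (hF j).1 (hφ i) ?_)
    rw [hij]
    exact hφ j
  have hsurj := Finite.injective_iff_surjective.1 hinj
  -- whichever vertex of the cycle `x i` covers, it is the one with index `φ i`
  have huniq : ∀ i j, G.Covers (x i) (v j) → φ i = j := by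
    intro i j hij
    obtain ⟨l, rfl⟩ := hsurj j
    rw [hx (hcov _ _ (hF i).1 _ (hF l).1 hij (hφ l))]
  obtain ⟨j, hj⟩ := Finite.exists_min fun j => ρ (v j)
  obtain ⟨i, rfl⟩ := hsurj j
  obtain ⟨hiF, hlink⟩ := hF i
  have hφi := hφ i
  rcases hxi : x i with e | a
  · rw [hxi] at hlink
    have h1 : φ i = i := huniq i i (by
      rw [hxi]
      change v i ∈ G.ends e
      rw [show G.ends e = _ from hlink]
      exact Sym2.mem_mk_left _ _)
    have h2 : φ i = i + 1 := huniq i (i + 1) (by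
      rw [hxi]
      change v (i + 1) ∈ G.ends e
      rw [show G.ends e = _ from hlink]
      exact Sym2.mem_mk_right _ _)
    rw [h1] at h2
    simp at h2
  · rw [hxi] at hlink hiF hφi
    have h1 : ρ (G.tail a) < ρ (v (φ i)) := by
      rw [show v (φ i) = G.head a from hφi]
      exact hρ a hiF
    have h2 : G.tail a ∈ s(v i, v (i + 1)) := by
      rw [← hlink]
      exact Sym2.mem_mk_left _ _
    rcases Sym2.mem_iff.1 h2 with h2 | h2
    · have := hj i
      rw [h2] at h1
      omega
    · have := hj (i + 1)
      rw [h2] at h1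
      omega

/-- In an acyclic set `F`, following arcs backwards leaves every nonempty set `U` whose vertices are
all heads of arcs of `F`. -/
lemma exists_arc_entering [Finite V] {F : Set (E ⊕ A)} (hF : ¬ G.HasCycle F) {U : Set V}
    (hU : U.Nonempty) (hhead : ∀ v ∈ U, ∃ a, Sum.inr a ∈ F ∧ G.head a = v) :
    ∃ a, Sum.inr a ∈ F ∧ G.head a ∈ U ∧ G.tail a ∉ U := by
  by_contra! hcon
  choose a ha using fun v : U => hhead v.1 v.2
  let f : U → U := fun v => ⟨G.tail (a v), hcon (a v) (ha v).1 (by rw [(ha v).2]; exact v.2)⟩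
  have hf : ∀ v : U, f v ≠ v := by
    intro v hv
    refine G.tail_ne_head (a v) ?_
    rw [(ha v).2]
    exact congrArg Subtype.val hv
  obtain ⟨u, hu⟩ := hU
  obtain ⟨p, hp⟩ : ∃ p : U, p ∈ Function.periodicPts f := by
    obtain ⟨m, n, hmn, heq⟩ :=
      Finite.exists_ne_map_eq_of_infinite fun n : ℕ => f^[n] (⟨u, hu⟩ : U)
    wlog hlt : m < n generalizing m n
    · exact this n m hmn.symm heq.symm (by omega)
    refine ⟨f^[m] ⟨u, hu⟩, Function.mk_mem_periodicPts (n := n - m) (by omega) ?_⟩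
    change f^[n - m] (f^[m] ⟨u, hu⟩) = _
    rw [← Function.iterate_add_apply, Nat.sub_add_cancel hlt.le]
    exact heq.symm
  have hpos := Function.minimalPeriod_pos_of_mem_periodicPts hp
  have hne : Function.minimalPeriod f p ≠ 1 := fun h => by
    have := Function.iterate_minimalPeriod (f := f) (x := p)
    rw [h] at this
    exact hf p this
  obtain ⟨n, hn⟩ : ∃ n, Function.minimalPeriod f p = n + 2 :=
    ⟨Function.minimalPeriod f p - 2, by omega⟩
  have hinj : Function.Injective fun i : Fin (n + 2) => f^[i.1] p := by
    intro i j hij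
    have hi : i.1 < Function.minimalPeriod f p := by rw [hn]; exact i.2
    have hj : j.1 < Function.minimalPeriod f p := by rw [hn]; exact j.2
    exact Fin.ext (Function.iterate_injOn_Iio_minimalPeriod hi hj hij)
  refine hF ⟨n, fun i => (f^[i.1] p).1, fun i => Sum.inr (a (f^[i.1] p)), ?_, ?_, ?_⟩
  · exact Subtype.val_injective.comp hinj
  · intro i j hij
    refine hinj (Subtype.ext ?_)
    change (f^[i.1] p).1 = (f^[j.1] p).1
    rw [← (ha (f^[i.1] p)).2, ← (ha (f^[j.1] p)).2, Sum.inr_injective hij]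
  · intro i
    refine ⟨(ha _).1, ?_⟩
    have h1 : f^[(i + 1 : Fin (n + 2)).1] p = f (f^[i.1] p) := by
      rw [← Function.iterate_succ_apply' f, ← Function.iterate_mod_minimalPeriod_eq (n := i.1 + 1),
        hn]
      congr 2
    have h2 : G.link (Sum.inr (a (f^[i.1] p))) =
        s((f (f^[i.1] p)).1, G.head (a (f^[i.1] p))) := rfl
    beta_reduce
    rw [h1, h2, (ha _).2, Sym2.eq_swap]

/-- Disjoint acyclic sets satisfy the cut condition for the sets of vertices that are not heads of
their arcs. -/
lemma cutCondition [Finite V] [DecidableEq V] {ι : Type*} [Fintype ι] {F : ι → Set (E ⊕ A)}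
    (hF : ∀ i, ¬ G.HasCycle (F i)) (hdisj : ∀ i j x, x ∈ F i → x ∈ F j → i = j)
    {D : Finset A} (hD : ∀ i a, Sum.inr a ∈ F i → a ∈ D) {R : ι → Finset V}
    (hR : ∀ i v, v ∉ R i → ∃ a, Sum.inr a ∈ F i ∧ G.head a = v) :
    CutCondition G.tail G.head D R := by
  intro U hU
  have hex : ∀ i : {i // Disjoint (R i) U}, ∃ a, Sum.inr a ∈ F i.1 ∧ G.head a ∈ U ∧ G.tail a ∉ U :=
    fun i => G.exists_arc_entering (hF i.1) (U := (U : Set V)) hU fun v hv =>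
      hR i.1 v (Finset.disjoint_right.1 i.2 hv)
  choose a ha using hex
  rw [demand, ← Fintype.card_subtype, ← Finset.card_univ]
  refine Finset.card_le_card_of_injOn a (fun i _ => ?_) (fun i _ j _ hij => ?_)
  · exact Finset.mem_coe.2 (mem_entering.2 ⟨hD i.1 _ (ha i).1, (ha i).2⟩)
  · refine Subtype.ext (hdisj i.1 j.1 _ (ha i).1 ?_)
    rw [hij]
    exact (ha j).1

end MixedGraph

/-! ### Exchanging the roots of two branchings -/

section Recolor

variable {V A : Type*} [Fintype V] [DecidableEq V] {tail head : A → V}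

/-- The two sets obtained from `R false` and `R true` by exchanging their roles on the vertices `v`
with `τ v = true`. -/
def recolor (R : Bool → Finset V) (τ : V → Bool) (i : Bool) : Finset V :=
  {v | v ∈ R (i ^^ τ v)}

lemma mem_recolor {R : Bool → Finset V} {τ : V → Bool} {i : Bool} {v : V} :
    v ∈ recolor R τ i ↔ v ∈ R (i ^^ τ v) := by
  simp [recolor]

/-- The roots of two branchings can be exchanged at will, provided that the two members of each of
certain disjoint pairs `{v, ν v}` are exchanged together. There is such a pair in each minimal
nonempty set that no arc enters, unless the set contains a common root; this keeps both root sets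
present in all such sets. -/
lemma CutCondition.exists_pairing {D : Finset A} {R : Bool → Finset V}
    (h : CutCondition tail head D R) :
    ∃ ν : V → V, Function.Involutive ν ∧
      (∀ v, ν v ≠ v → ∃ i, v ∈ R i ∧ v ∉ R (!i) ∧ ν v ∈ R (!i) ∧ ν v ∉ R i) ∧
      ∀ τ : V → Bool, (∀ v, τ (ν v) = τ v) → CutCondition tail head D (recolor R τ) := by
  classical
  let P : Finset V → Prop := fun U => U.Nonempty ∧ entering tail head D U = ∅
  have hmeet : ∀ U, P U → ∀ i, ∃ v ∈ U, v ∈ R i := by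
    intro U hU i
    have h0 := h U hU.1
    rw [hU.2, Finset.card_empty, Nat.le_zero, demand, Finset.card_eq_zero,
      Finset.filter_eq_empty_iff] at h0
    obtain ⟨v, hv, hvU⟩ := Finset.not_disjoint_iff.1 (h0 (Finset.mem_univ i))
    exact ⟨v, hvU, hv⟩
  have heq : ∀ U W, Minimal P U → Minimal P W → ∀ v, v ∈ U → v ∈ W → U = W := by
    intro U W hU hW v hvU hvW
    have hP : P (U ∩ W) := by
      refine ⟨⟨v, Finset.mem_inter.2 ⟨hvU, hvW⟩⟩, ?_⟩
      refine Finset.eq_empty_of_forall_notMem fun a ha => ?_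
      obtain ⟨haD, hh, ht⟩ := mem_entering.1 ha
      obtain ⟨hhU, hhW⟩ := Finset.mem_inter.1 hh
      by_cases htU : tail a ∈ U
      · have htW : tail a ∉ W := fun hc => ht (Finset.mem_inter.2 ⟨htU, hc⟩)
        exact Finset.notMem_empty a (hW.prop.2 ▸ mem_entering.2 ⟨haD, hhW, htW⟩)
      · exact Finset.notMem_empty a (hU.prop.2 ▸ mem_entering.2 ⟨haD, hhU, htU⟩)
    exact (hU.eq_of_le hP Finset.inter_subset_left).symm.trans
      (hW.eq_of_le hP Finset.inter_subset_right)
  let T := {U : Finset V // Minimal P U ∧ ∀ v ∈ U, ¬ (v ∈ R false ∧ v ∈ R true)}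
  choose p hpU hpR using fun U : T => hmeet U.1 U.2.1.prop false
  choose q hqU hqR using fun U : T => hmeet U.1 U.2.1.prop true
  let ν : V → V := fun v =>
    if hv : ∃ U : T, v ∈ U.1 then Equiv.swap (p hv.choose) (q hv.choose) v else v
  have hν : ∀ (U : T) v, v ∈ U.1 → ν v = Equiv.swap (p U) (q U) v := by
    intro U v hv
    have hex : ∃ U : T, v ∈ U.1 := ⟨U, hv⟩
    have : hex.choose = U :=
      Subtype.ext (heq _ _ hex.choose.2.1 U.2.1 v hex.choose_spec hv)
    simp only [ν, dif_pos hex, this]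
  have hνU : ∀ (U : T) v, v ∈ U.1 → ν v ∈ U.1 := by
    intro U v hv
    rw [hν U v hv]
    by_cases h1 : v = p U
    · rw [h1, Equiv.swap_apply_left]; exact hqU U
    · by_cases h2 : v = q U
      · rw [h2, Equiv.swap_apply_right]; exact hpU U
      · rwa [Equiv.swap_apply_of_ne_of_ne h1 h2]
  have hν' : ∀ v, (¬ ∃ U : T, v ∈ U.1) → ν v = v := fun v hv => by simp only [ν, dif_neg hv]
  refine ⟨ν, ?_, ?_, ?_⟩
  · intro v
    by_cases hv : ∃ U : T, v ∈ U.1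
    · obtain ⟨U, hU⟩ := hv
      rw [hν U _ (hνU U v hU), hν U v hU]
      exact (Equiv.swap (p U) (q U)).symm_apply_apply v
    · rw [hν' v hv, hν' v hv]
  · intro v hv
    by_cases hvT : ∃ U : T, v ∈ U.1
    · obtain ⟨U, hU⟩ := hvT
      have hpt : p U ∉ R true := fun hc => U.2.2 _ (hpU U) ⟨hpR U, hc⟩
      have hqf : q U ∉ R false := fun hc => U.2.2 _ (hqU U) ⟨hc, hqR U⟩
      rw [hν U v hU] at hv ⊢
      by_cases h1 : v = p U
      · rw [h1, Equiv.swap_apply_left]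
        exact ⟨false, hpR U, hpt, hqR U, hqf⟩
      · by_cases h2 : v = q U
        · rw [h2, Equiv.swap_apply_right]
          exact ⟨true, hqR U, hqf, hpR U, hpt⟩
        · exact absurd (Equiv.swap_apply_of_ne_of_ne h1 h2) hv
    · exact absurd (hν' v hvT) hv
  · intro τ hτ U hU
    have hclosed : entering tail head D U = ∅ → demand (recolor R τ) U = 0 := by
      intro hempty
      obtain ⟨W, hWU, hW⟩ := exists_minimal_le_of_wellFoundedLT P U ⟨hU, hempty⟩
      rw [demand, Finset.card_eq_zero, Finset.filter_eq_empty_iff]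
      intro i _ hdis
      have hWdis : ∀ v ∈ W, v ∉ R (i ^^ τ v) := fun v hv hc =>
        Finset.disjoint_right.1 hdis (hWU hv) (mem_recolor.2 hc)
      by_cases hWT : ∀ v ∈ W, ¬ (v ∈ R false ∧ v ∈ R true)
      · let W' : T := ⟨W, hW, hWT⟩
        have hpq : ν (p W') = q W' := by
          rw [hν W' _ (hpU W'), Equiv.swap_apply_left]
        have hp := hWdis _ (hpU W')
        have hq := hWdis _ (hqU W')
        rw [← hpq, hτ, hpq] at hq
        cases hb : (i ^^ τ (p W')) with
        | false => exact hp (hb ▸ hpR W')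
        | true => exact hq (hb ▸ hqR W')
      · push Not at hWT
        obtain ⟨v, hv, hv1, hv2⟩ := hWT
        refine hWdis v hv ?_
        cases (i ^^ τ v) <;> assumption
    rcases (entering tail head D U).eq_empty_or_nonempty with h0 | h0
    · rw [hclosed h0]
      exact Nat.zero_le _
    · by_cases h1 : ∃ i, ¬ Disjoint (recolor R τ i) U
      · obtain ⟨i, hi⟩ := h1
        have hsub : (Finset.univ.filter fun j => Disjoint (recolor R τ j) U) ⊆ {!i} := by
          intro j hj
          have hji : j ≠ i := fun hc => hi (hc ▸ (Finset.mem_filter.1 hj).2)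
          rw [Finset.mem_singleton]
          revert hji
          cases i <;> cases j <;> simp
        have := Finset.card_le_card hsub
        rw [Finset.card_singleton] at this
        exact this.trans (Finset.card_pos.2 h0)
      · push Not at h1
        refine le_trans ?_ (h U hU)
        have hall : ∀ i, Disjoint (R i) U := by
          intro i
          refine Finset.disjoint_right.2 fun v hv hc => ?_
          refine Finset.disjoint_right.1 (h1 (i ^^ τ v)) hv (mem_recolor.2 ?_)
          rwa [Bool.xor_assoc, Bool.xor_self, Bool.xor_false]
        refine Finset.card_le_card fun i _ => ?_
        exact Finset.mem_filter.2 ⟨Finset.mem_univ i, hall i⟩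

end Recolor

/-! ### Signed sums of small vectors -/

/-- The sign `-1` for `true` and `1` for `false`. -/
def boolSign (b : Bool) : ℤ := bif b then -1 else 1

/-- The vectors in `{-1, 0, 1}²` are, up to sign, the vectors `(1, 1)`, `(1, -1)`, `(1, 0)`,
`(0, 1)` and `(0, 0)`. Vectors of the same kind cancel in pairs, so that at most one of each nonzero
kind is left, and the signs of the remaining ones are free. -/
lemma exists_signs_residual {ι : Type*} (s : Finset ι) (m f : ι → ℤ)
    (hm : ∀ i, |m i| ≤ 1) (hf : ∀ i, |f i| ≤ 1) :
    ∃ x y p q : Bool, ∀ σ₁ σ₂ σ₃ σ₄ : Bool, ∃ ε : ι → Bool,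
      ∑ i ∈ s, boolSign (ε i) * m i = (bif x then boolSign σ₁ else 0) +
        (bif y then boolSign σ₂ else 0) + (bif p then boolSign σ₃ else 0) ∧
      ∑ i ∈ s, boolSign (ε i) * f i = (bif x then boolSign σ₁ else 0) -
        (bif y then boolSign σ₂ else 0) + (bif q then boolSign σ₄ else 0) := by
  classical
  induction s using Finset.induction_on with
  | empty => exact ⟨false, false, false, false, by simp⟩
  | insert a s ha ih =>
    have hext : ∀ (ε : ι → Bool) (e : Bool), ∃ ε' : ι → Bool,
        ∑ i ∈ insert a s, boolSign (ε' i) * m i =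
          boolSign e * m a + ∑ i ∈ s, boolSign (ε i) * m i ∧
        ∑ i ∈ insert a s, boolSign (ε' i) * f i =
          boolSign e * f a + ∑ i ∈ s, boolSign (ε i) * f i := by
      intro ε e
      refine ⟨Function.update ε a e, ?_, ?_⟩ <;>
      · rw [Finset.sum_insert ha, Function.update_self]
        congr 1
        refine Finset.sum_congr rfl fun i hi => ?_
        rw [Function.update_of_ne (ne_of_mem_of_not_mem hi ha)]
    obtain ⟨x, y, p, q, h⟩ := ih
    have hclass : (m a = 0 ∧ f a = 0) ∨ ∃ b : Bool,
        (m a = boolSign b ∧ f a = boolSign b) ∨ (m a = boolSign b ∧ f a = -boolSign b) ∨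
        (m a = boolSign b ∧ f a = 0) ∨ (m a = 0 ∧ f a = boolSign b) := by
      have h1 := abs_le.1 (hm a)
      have h2 := abs_le.1 (hf a)
      have h3 : m a = -1 ∨ m a = 0 ∨ m a = 1 := by omega
      have h4 : f a = -1 ∨ f a = 0 ∨ f a = 1 := by omega
      rcases h3 with h3 | h3 | h3 <;> rcases h4 with h4 | h4 | h4 <;>
        simp [h3, h4, boolSign]
    have hsq : ∀ b : Bool, boolSign b * boolSign b = 1 := by decide
    have hneg : ∀ b : Bool, boolSign (!b) * boolSign b = -1 := by decide
    have hxor : ∀ b c : Bool, boolSign (b ^^ c) * boolSign c = boolSign b := by decide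
    -- a vector of a kind without residue becomes the residue, otherwise it cancels the residue
    rcases hclass with ⟨h1, h2⟩ | ⟨b, ⟨h1, h2⟩ | ⟨h1, h2⟩ | ⟨h1, h2⟩ | ⟨h1, h2⟩⟩
    · refine ⟨x, y, p, q, fun σ₁ σ₂ σ₃ σ₄ => ?_⟩
      obtain ⟨ε, hε1, hε2⟩ := h σ₁ σ₂ σ₃ σ₄
      obtain ⟨ε', h3, h4⟩ := hext ε false
      exact ⟨ε', by rw [h3, h1, hε1]; ring, by rw [h4, h2, hε2]; ring⟩
    · refine ⟨!x, y, p, q, fun σ₁ σ₂ σ₃ σ₄ => ?_⟩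
      obtain ⟨ε, hε1, hε2⟩ := h false σ₂ σ₃ σ₄
      obtain ⟨ε', h3, h4⟩ := hext ε (bif x then !b else σ₁ ^^ b)
      refine ⟨ε', ?_, ?_⟩
      · rw [h3, h1, hε1]; cases x <;> simp [hneg, hxor, boolSign.eq_1 false] <;> ring
      · rw [h4, h2, hε2]; cases x <;> simp [hneg, hxor, boolSign.eq_1 false] <;> ring
    · refine ⟨x, !y, p, q, fun σ₁ σ₂ σ₃ σ₄ => ?_⟩
      obtain ⟨ε, hε1, hε2⟩ := h σ₁ false σ₃ σ₄
      obtain ⟨ε', h3, h4⟩ := hext ε (bif y then !b else σ₂ ^^ b)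
      refine ⟨ε', ?_, ?_⟩
      · rw [h3, h1, hε1]; cases y <;> simp [hneg, hxor, boolSign.eq_1 false] <;> ring
      · rw [h4, h2, hε2]; cases y <;> simp [hneg, hxor, boolSign.eq_1 false] <;> ring
    · refine ⟨x, y, !p, q, fun σ₁ σ₂ σ₃ σ₄ => ?_⟩
      obtain ⟨ε, hε1, hε2⟩ := h σ₁ σ₂ false σ₄
      obtain ⟨ε', h3, h4⟩ := hext ε (bif p then !b else σ₃ ^^ b)
      refine ⟨ε', ?_, ?_⟩
      · rw [h3, h1, hε1]
        cases p <;> simp [hneg, hxor, boolSign.eq_1 false]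
        ring
      · rw [h4, h2, hε2]; ring
    · refine ⟨x, y, p, !q, fun σ₁ σ₂ σ₃ σ₄ => ?_⟩
      obtain ⟨ε, hε1, hε2⟩ := h σ₁ σ₂ σ₃ false
      obtain ⟨ε', h3, h4⟩ := hext ε (bif q then !b else σ₄ ^^ b)
      refine ⟨ε', ?_, ?_⟩
      · rw [h3, h1, hε1]; ring
      · rw [h4, h2, hε2]
        cases q <;> simp [hneg, hxor, boolSign.eq_1 false]
        ring

lemma exists_balanced_signs {ι : Type*} (s : Finset ι) (m f : ι → ℤ)
    (hm : ∀ i, |m i| ≤ 1) (hf : ∀ i, |f i| ≤ 1) :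
    ∃ ε : ι → Bool, |∑ i ∈ s, boolSign (ε i) * f i| ≤ 1 ∧ |∑ i ∈ s, boolSign (ε i) * m i| ≤ 2 ∧
      |∑ i ∈ s, boolSign (ε i) * f i - ∑ i ∈ s, boolSign (ε i) * m i| ≤ 2 := by
  obtain ⟨x, y, p, q, h⟩ := exists_signs_residual s m f hm hf
  -- `(1, 1)` and `(1, -1)` add up to `(2, 0)`, which `(1, 0)` reduces; `(0, 1)` then corrects the
  -- second coordinate, or is harmless
  obtain ⟨ε, h1, h2⟩ := h false false true (!y)
  refine ⟨ε, ?_⟩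
  rw [h1, h2]
  clear h h1 h2
  revert x y p q
  decide

/-! ### Components of a graph of maximum degree two -/

section Components

variable {V : Type*} [Fintype V]

/-- A connected graph on `n` vertices has at least `n - 1` edges, so the sum of its degrees is at
least `2 * n - 2`. -/
lemma SimpleGraph.ConnectedComponent.sum_two_sub_degree_le (H : SimpleGraph V)
    [DecidableRel H.Adj] [DecidableEq H.ConnectedComponent] (C : H.ConnectedComponent) :
    ∑ v with H.connectedComponentMk v = C, (2 - (H.degree v : ℤ)) ≤ 2 := by
  classical
  have hconn : (H.induce C.supp).Connected := C.connected_toSimpleGraph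
  have h1 := hconn.card_vert_le_card_edgeSet_add_one
  have h2 := (H.induce C.supp).sum_degrees_eq_twice_card_edges
  rw [Nat.card_eq_fintype_card, Nat.card_eq_fintype_card, ← SimpleGraph.edgeFinset_card] at h1
  have h3 : ∑ v with H.connectedComponentMk v = C, (2 - (H.degree v : ℤ)) =
      ∑ v : C.supp, (2 - (H.degree v.1 : ℤ)) := by
    refine Finset.sum_subtype _ (fun v => ?_) _
    simp [SimpleGraph.ConnectedComponent.mem_supp_iff]
  have h4 : ∑ v : C.supp, (2 - (H.degree v.1 : ℤ)) ≤
      ∑ v : C.supp, (2 - ((H.induce C.supp).degree v : ℤ)) := by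
    refine Finset.sum_le_sum fun v _ => ?_
    have : (H.induce C.supp).degree v ≤ H.degree v.1 :=
      Finset.card_le_card_of_injOn Subtype.val (fun w hw => by simpa using hw)
        Subtype.val_injective.injOn
    omega
  have h5 : ∑ v : C.supp, (2 - ((H.induce C.supp).degree v : ℤ)) =
      2 * (Fintype.card C.supp : ℤ) - ((∑ v, (H.induce C.supp).degree v : ℕ) : ℤ) := by
    rw [Finset.sum_sub_distrib, Finset.sum_const, Finset.card_univ]
    push_cast
    ring
  rw [h3]
  refine h4.trans ?_
  rw [h5, h2]
  push_cast
  omega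

/-- Let `S i ⊆ R i` be the sets of covered vertices and of roots of two matching forests, and let
`H` consist of the edges of the two matchings and of the pairs `{v, ν v}`. In a component of `H`,
the pairs cancel in both sums below, and then only vertices of degree less than two contribute. -/
lemma component_sums_le [DecidableEq V] (S R : Bool → Finset V) (ν : V → V) (H : SimpleGraph V)
    [DecidableRel H.Adj] [DecidableEq H.ConnectedComponent] (hSR : ∀ i, S i ⊆ R i)
    (hν : Function.Involutive ν)
    (hνR : ∀ v, ν v ≠ v → ∃ i, v ∈ R i ∧ v ∉ R (!i) ∧ ν v ∈ R (!i) ∧ ν v ∉ R i)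
    (hνH : ∀ v, H.connectedComponentMk (ν v) = H.connectedComponentMk v)
    (hdeg : ∀ v, H.degree v ≤ (if v ∈ S false then 1 else 0) + (if v ∈ S true then 1 else 0) +
      (if ν v ≠ v then 1 else 0)) (C : H.ConnectedComponent) :
    |∑ v with H.connectedComponentMk v = C,
      ((if v ∈ S false then 1 else 0) - (if v ∈ S true then 1 else 0) : ℤ)| ≤ 2 ∧
    |∑ v with H.connectedComponentMk v = C,
      (((if v ∈ S false then 1 else 0) - (if v ∈ S true then 1 else 0)) -
        2 * ((if v ∈ R false then 1 else 0) - (if v ∈ R true then 1 else 0)) : ℤ)| ≤ 2 := by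
  set c : V → ℤ := fun v => (if v ∈ S false then 1 else 0) - (if v ∈ S true then 1 else 0)
  set r : V → ℤ := fun v => (if v ∈ R false then 1 else 0) - (if v ∈ R true then 1 else 0)
  let t : V → ℤ := fun v => if ν v ≠ v then r v else 0
  have ht : ∑ v with H.connectedComponentMk v = C, t v = 0 := by
    refine Finset.sum_involution (fun v _ => ν v) (fun v _ => ?_) (fun v _ hv => ?_)
      (fun v hv => ?_) (fun v _ => hν v)
    · by_cases h : ν v = v
      · simp [t, h]
      · have h' : ν (ν v) ≠ ν v := fun hcon => h (hν.injective hcon)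
        obtain ⟨i, h1, h2, h3, h4⟩ := hνR v h
        cases i <;> simp_all [t, r]
    · intro hcon
      simp [t, hcon] at hv
    · rw [Finset.mem_filter] at hv ⊢
      exact ⟨Finset.mem_univ _, (hνH v).trans hv.2⟩
  have hpt : ∀ v, |c v - t v| ≤ 2 - (H.degree v : ℤ) ∧
      |c v - 2 * r v + t v| ≤ 2 - (H.degree v : ℤ) := by
    intro v
    have hd := hdeg v
    have hS0 := @hSR false v
    have hS1 := @hSR true v
    by_cases hfix : ν v = v
    · by_cases h1 : v ∈ S false <;> by_cases h2 : v ∈ S true <;> by_cases h3 : v ∈ R false <;>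
        by_cases h4 : v ∈ R true <;> simp [h1, h2, h3, h4, hfix, t, c, r] at hS0 hS1 hd ⊢ <;>
        omega
    · obtain ⟨i, h3, h4, -, -⟩ := hνR v hfix
      cases i <;> by_cases h1 : v ∈ S false <;> by_cases h2 : v ∈ S true <;>
        simp_all [t, c, r] <;> omega
  have hsum := SimpleGraph.ConnectedComponent.sum_two_sub_degree_le H C
  constructor
  · calc |∑ v with H.connectedComponentMk v = C, c v|
        = |∑ v with H.connectedComponentMk v = C, (c v - t v)| := by
          rw [Finset.sum_sub_distrib c t, ht, sub_zero]
      _ ≤ _ := (Finset.abs_sum_le_sum_abs _ _).trans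
          ((Finset.sum_le_sum fun v _ => (hpt v).1).trans hsum)
  · calc |∑ v with H.connectedComponentMk v = C, (c v - 2 * r v)|
        = |∑ v with H.connectedComponentMk v = C, (c v - 2 * r v + t v)| := by
          rw [Finset.sum_add_distrib (f := fun v => c v - 2 * r v) (g := t), ht, add_zero]
      _ ≤ _ := (Finset.abs_sum_le_sum_abs _ _).trans
          ((Finset.sum_le_sum fun v _ => (hpt v).2).trans hsum)

end Components

/-! ### Repartitioning two matching forests -/

section Counting

variable {V A : Type*} [Fintype V] [DecidableEq V]

lemma card_recolor_sub_card_recolor (R : Bool → Finset V) {κ : Type*} [Fintype κ] [DecidableEq κ]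
    (comp : V → κ) (ε : κ → Bool) :
    ((recolor R (fun v => ε (comp v)) false).card : ℤ) -
        (recolor R (fun v => ε (comp v)) true).card =
      ∑ C, boolSign (ε C) *
        ∑ v with comp v = C, ((if v ∈ R false then 1 else 0) - (if v ∈ R true then 1 else 0)) := by
  have h : ∀ i, ((recolor R (fun v => ε (comp v)) i).card : ℤ) =
      ∑ v, if v ∈ R (i ^^ ε (comp v)) then 1 else 0 := by
    intro i
    rw [recolor, Finset.card_filter]
    push_cast
    rfl
  rw [h, h, ← Finset.sum_sub_distrib, ← Finset.sum_fiberwise Finset.univ comp]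
  refine Finset.sum_congr rfl fun C _ => ?_
  rw [Finset.mul_sum]
  refine Finset.sum_congr rfl fun v hv => ?_
  rw [(Finset.mem_filter.1 hv).2]
  cases ε C <;> simp [boolSign]

lemma card_recolor_add_card_recolor (R : Bool → Finset V) (τ : V → Bool) :
    (recolor R τ false).card + (recolor R τ true).card = (R false).card + (R true).card := by
  have h : ∀ T : Finset V, T.card = ∑ v, if v ∈ T then 1 else 0 := fun T => by simp
  rw [h, h, h (R false), h (R true), ← Finset.sum_add_distrib, ← Finset.sum_add_distrib]
  refine Finset.sum_congr rfl fun v _ => ?_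
  simp only [mem_recolor]
  cases τ v <;> simp [add_comm]

lemma card_add_card_of_heads {head : A → V} {B : Finset A} {R : Finset V}
    (h1 : ∀ a ∈ B, head a ∉ R) (h2 : ∀ v ∉ R, ∃ a ∈ B, head a = v)
    (h3 : ∀ a ∈ B, ∀ b ∈ B, head a = head b → a = b) :
    B.card + R.card = Fintype.card V := by
  have h : B.image head = Rᶜ := by
    ext v
    rw [Finset.mem_image, Finset.mem_compl]
    exact ⟨fun ⟨a, ha, hav⟩ => hav ▸ h1 a ha, h2 v⟩
  rw [← Finset.card_image_of_injOn (f := head) (s := B) fun a ha b hb => h3 a ha b hb, h,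
    Finset.card_compl_add_card]

end Counting

lemma ncard_eq_edgePart_add_arcPart {E A : Type*} [Finite E] [Finite A] (F : Set (E ⊕ A)) :
    F.ncard = (edgePart F).ncard + (arcPart F).ncard := by
  have h : F = Sum.inl '' edgePart F ∪ Sum.inr '' arcPart F := by
    ext x
    rcases x with e | a <;> simp [edgePart, arcPart]
  conv_lhs => rw [h]
  rw [Set.ncard_union_eq, Set.ncard_image_of_injective _ Sum.inl_injective,
    Set.ncard_image_of_injective _ Sum.inr_injective]
  rw [Set.disjoint_left]
  rintro _ ⟨e, -, rfl⟩ ⟨a, -, h⟩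
  exact Sum.inr_ne_inl h

namespace MixedGraph

variable {V E A : Type*} (G : MixedGraph V E A)

lemma card_covered_eq_two_mul [Fintype V] [DecidableEq V] (M : Finset E)
    (hM : ∀ v, ∀ e ∈ M, ∀ e' ∈ M, v ∈ G.ends e → v ∈ G.ends e' → e = e') {S : Finset V}
    (hS : ∀ v, v ∈ S ↔ ∃ e ∈ M, v ∈ G.ends e) : S.card = 2 * M.card := by
  have h : S = M.biUnion fun e => (G.ends e).toFinset := by
    ext v
    simp [hS]
  rw [h, Finset.card_biUnion]
  · rw [Finset.sum_congr rfl fun e _ =>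
      Sym2.card_toFinset_of_not_isDiag _ (G.ends_not_isDiag e), Finset.sum_const, smul_eq_mul,
      mul_comm]
  · intro e he e' he' hne
    refine Finset.disjoint_left.2 fun v hv hv' => ?_
    exact hne (hM v e he e' he' (Sym2.mem_toFinset.1 hv) (Sym2.mem_toFinset.1 hv'))

/-- The graph on the vertices formed by the edges of the matchings `M i` and the pairs
`{v, ν v}`. -/
def exchangeGraph (M : Bool → Finset E) (ν : V → V) : SimpleGraph V :=
  SimpleGraph.fromRel fun u w => (∃ i, ∃ e ∈ M i, G.ends e = s(u, w)) ∨ ν u = w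

variable {G} in
lemma exchangeGraph_adj {M : Bool → Finset E} {ν : V → V} (hν : Function.Involutive ν) {u w : V} :
    (G.exchangeGraph M ν).Adj u w ↔
      u ≠ w ∧ ((∃ i, ∃ e ∈ M i, G.ends e = s(u, w)) ∨ ν u = w) := by
  rw [exchangeGraph, SimpleGraph.fromRel_adj, Sym2.eq_swap (a := w)]
  have : ν w = u ↔ ν u = w := ⟨fun h => h ▸ hν w, fun h => h ▸ hν u⟩
  rw [this, or_self]

lemma degree_exchangeGraph_le [Fintype V] [DecidableEq V] {M : Bool → Finset E} {ν : V → V}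
    [DecidableRel (G.exchangeGraph M ν).Adj] (hν : Function.Involutive ν)
    (hM : ∀ i v, ∀ e ∈ M i, ∀ e' ∈ M i, v ∈ G.ends e → v ∈ G.ends e' → e = e')
    {S : Bool → Finset V} (hS : ∀ i v, v ∈ S i ↔ ∃ e ∈ M i, v ∈ G.ends e) (v : V) :
    (G.exchangeGraph M ν).degree v ≤ (if v ∈ S false then 1 else 0) +
      (if v ∈ S true then 1 else 0) + (if ν v ≠ v then 1 else 0) := by
  classical
  let N : Bool → Finset V := fun i => {w | ∃ e ∈ M i, G.ends e = s(v, w)}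
  have hN : ∀ i, (N i).card ≤ if v ∈ S i then 1 else 0 := by
    intro i
    split_ifs with hv
    · rw [Finset.card_le_one]
      intro w hw w' hw'
      obtain ⟨e, he, hew⟩ := (Finset.mem_filter.1 hw).2
      obtain ⟨e', he', hew'⟩ := (Finset.mem_filter.1 hw').2
      have hee : e = e' := hM i v e he e' he' (hew ▸ Sym2.mem_mk_left _ _)
        (hew' ▸ Sym2.mem_mk_left _ _)
      rw [hee, hew'] at hew
      exact (Sym2.congr_right.1 hew).symm
    · rw [Nat.le_zero, Finset.card_eq_zero, Finset.eq_empty_iff_forall_notMem]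
      intro w hw
      obtain ⟨e, he, hew⟩ := (Finset.mem_filter.1 hw).2
      exact hv ((hS i v).2 ⟨e, he, hew ▸ Sym2.mem_mk_left _ _⟩)
  have hP : (({ν v} : Finset V).erase v).card ≤ if ν v ≠ v then 1 else 0 := by
    split_ifs with hv
    · exact (Finset.card_erase_le).trans (Finset.card_singleton _).le
    · rw [not_not.1 hv]
      simp
  have hsub : (G.exchangeGraph M ν).neighborFinset v ⊆
      (N false ∪ N true) ∪ ({ν v} : Finset V).erase v := by
    intro w hw
    rw [SimpleGraph.mem_neighborFinset, exchangeGraph_adj hν] at hw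
    obtain ⟨hne, ⟨i, e, he, hew⟩ | hw⟩ := hw
    · refine Finset.mem_union_left _ ?_
      have hwN : w ∈ N i := Finset.mem_filter.2 ⟨Finset.mem_univ _, e, he, hew⟩
      cases i
      · exact Finset.mem_union_left _ hwN
      · exact Finset.mem_union_right _ hwN
    · refine Finset.mem_union_right _ ?_
      simp [hw, hne.symm]
  have h1 := Finset.card_le_card hsub
  have h2 := Finset.card_union_le (N false ∪ N true) (({ν v} : Finset V).erase v)
  have h3 := Finset.card_union_le (N false) (N true)
  have h4 := hN false
  have h5 := hN true
  rw [SimpleGraph.card_neighborFinset_eq_degree] at h1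
  omega

/-- Two disjoint matching forests can be repartitioned into two balanced ones: exchange their
matchings and root sets on suitably chosen components of the exchange graph, and use Edmonds'
theorem to find branchings with the new root sets. -/
theorem exists_balanced_repartition [Finite V] [Finite E] [Finite A] {F : Bool → Set (E ⊕ A)}
    (hF : ∀ i, G.IsMatchingForest (F i)) (hdisj : ∀ i j x, x ∈ F i → x ∈ F j → i = j) :
    ∃ F' : Bool → Set (E ⊕ A), (∀ i, G.IsMatchingForest (F' i)) ∧
      (∀ i j x, x ∈ F' i → x ∈ F' j → i = j) ∧ (∀ x, (∃ i, x ∈ F' i) ↔ ∃ i, x ∈ F i) ∧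
      |((F' false).ncard : ℤ) - (F' true).ncard| ≤ 1 ∧
      |((edgePart (F' false)).ncard : ℤ) - (edgePart (F' true)).ncard| ≤ 2 ∧
      |((arcPart (F' false)).ncard : ℤ) - (arcPart (F' true)).ncard| ≤ 2 := by
  classical
  cases nonempty_fintype V
  cases nonempty_fintype E
  cases nonempty_fintype A
  let M : Bool → Finset E := fun i => {e | Sum.inl e ∈ F i}
  let B : Bool → Finset A := fun i => {a | Sum.inr a ∈ F i}
  let D : Finset A := B false ∪ B true
  let S : Bool → Finset V := fun i => {v | ∃ e ∈ M i, v ∈ G.ends e}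
  let R : Bool → Finset V := fun i => {v | ∀ a ∈ B i, G.head a ≠ v}
  have hMF : ∀ i e, e ∈ M i ↔ Sum.inl e ∈ F i := fun i e => by simp [M]
  have hBF : ∀ i a, a ∈ B i ↔ Sum.inr a ∈ F i := fun i a => by simp [B]
  have hS : ∀ i v, v ∈ S i ↔ ∃ e ∈ M i, v ∈ G.ends e := fun i v => by simp [S]
  have hR : ∀ i v, v ∈ R i ↔ ∀ a ∈ B i, G.head a ≠ v := fun i v => by simp [R]
  have hM : ∀ i v, ∀ e ∈ M i, ∀ e' ∈ M i, v ∈ G.ends e → v ∈ G.ends e' → e = e' :=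
    fun i v e he e' he' hv hv' =>
      Sum.inl_injective ((hF i).2 v _ ((hMF i e).1 he) _ ((hMF i e').1 he') hv hv')
  have hMdisj : ∀ i j e, e ∈ M i → e ∈ M j → i = j := fun i j e hi hj =>
    hdisj i j _ ((hMF i e).1 hi) ((hMF j e).1 hj)
  have hSR : ∀ i, S i ⊆ R i := by
    intro i v hv
    obtain ⟨e, he, hve⟩ := (hS i v).1 hv
    refine (hR i v).2 fun a ha hav => ?_
    exact Sum.inl_ne_inr ((hF i).2 v _ ((hMF i e).1 he) _ ((hBF i a).1 ha) hve hav.symm)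
  have hRex : ∀ i v, v ∉ R i → ∃ a ∈ B i, G.head a = v := by
    intro i v hv
    rw [hR] at hv
    push Not at hv
    exact hv
  have hcut : CutCondition G.tail G.head D R := by
    refine G.cutCondition (fun i => (hF i).1) hdisj (fun i a ha => ?_) fun i v hv => ?_
    · cases i
      · exact Finset.mem_union_left _ ((hBF _ a).2 ha)
      · exact Finset.mem_union_right _ ((hBF _ a).2 ha)
    · obtain ⟨a, ha, hav⟩ := hRex i v hv
      exact ⟨a, (hBF i a).1 ha, hav⟩
  obtain ⟨ν, hν, hνR, hνcut⟩ := hcut.exists_pairing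
  let H := G.exchangeGraph M ν
  let comp := H.connectedComponentMk
  have hνH : ∀ v, comp (ν v) = comp v := by
    intro v
    by_cases hv : ν v = v
    · rw [hv]
    · refine (SimpleGraph.ConnectedComponent.sound (SimpleGraph.Adj.reachable ?_)).symm
      exact (exchangeGraph_adj hν).2 ⟨Ne.symm hv, Or.inr rfl⟩
  have hMH : ∀ i, ∀ e ∈ M i, ∀ u ∈ G.ends e, ∀ w ∈ G.ends e, comp u = comp w := by
    intro i e he u hu w hw
    by_cases huw : u = w
    · rw [huw]
    · refine SimpleGraph.ConnectedComponent.sound (SimpleGraph.Adj.reachable ?_)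
      exact (exchangeGraph_adj hν).2
        ⟨huw, Or.inl ⟨i, e, he, (Sym2.mem_and_mem_iff huw).1 ⟨hu, hw⟩⟩⟩
  have hcomp := component_sums_le S R ν H hSR hν hνR hνH (G.degree_exchangeGraph_le hν hM hS)
  let MC : Bool → H.ConnectedComponent → Finset E := fun i C =>
    {e ∈ M i | ∃ v ∈ G.ends e, comp v = C}
  have hMC : ∀ i C, (∑ v with comp v = C, (if v ∈ S i then 1 else 0) : ℤ) = 2 * (MC i C).card := by
    intro i C
    rw [Finset.sum_boole, Finset.filter_filter]
    have := G.card_covered_eq_two_mul (MC i C) (fun v e he e' he' =>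
      hM i v e (Finset.mem_filter.1 he).1 e' (Finset.mem_filter.1 he').1)
      (S := Finset.univ.filter fun v => comp v = C ∧ v ∈ S i) ?_
    · rw [this]
      push_cast
      rfl
    · intro v
      simp only [Finset.mem_filter, Finset.mem_univ, true_and, MC, hS]
      constructor
      · rintro ⟨hvC, e, he, hve⟩
        exact ⟨e, ⟨he, v, hve, hvC⟩, hve⟩
      · rintro ⟨e, ⟨he, u, hu, huC⟩, hve⟩
        exact ⟨(hMH i e he v hve u hu).trans huC, e, he, hve⟩
  let m : H.ConnectedComponent → ℤ := fun C => (MC false C).card - (MC true C).card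
  let r : H.ConnectedComponent → ℤ := fun C =>
    ∑ v with comp v = C, ((if v ∈ R false then 1 else 0) - (if v ∈ R true then 1 else 0))
  have hm : ∀ C, ∑ v with comp v = C,
      ((if v ∈ S false then 1 else 0) - (if v ∈ S true then 1 else 0) : ℤ) = 2 * m C := by
    intro C
    rw [Finset.sum_sub_distrib, hMC, hMC]
    ring
  have hm1 : ∀ C, |m C| ≤ 1 := by
    intro C
    have := (hcomp C).1
    rw [hm C, abs_le] at this
    rw [abs_le]
    omega
  have hf1 : ∀ C, |m C - r C| ≤ 1 := by
    intro C
    have := (hcomp C).2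
    rw [Finset.sum_sub_distrib, ← Finset.mul_sum, hm C, abs_le] at this
    change _ ≤ 2 * m C - 2 * r C ∧ 2 * m C - 2 * r C ≤ _ at this
    rw [abs_le]
    omega
  obtain ⟨ε, hε1, hε2, hε3⟩ := exists_balanced_signs Finset.univ m (fun C => m C - r C) hm1 hf1
  let τ : V → Bool := fun v => ε (comp v)
  obtain ⟨B', hB'D, hB'disj, hB'⟩ :=
    (hνcut τ fun v => congrArg ε (hνH v)).exists_branchings
  let M' : Bool → Finset E := fun i => {e | ∃ v ∈ G.ends e, e ∈ M (i ^^ τ v)}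
  have hM' : ∀ i e v, v ∈ G.ends e → (e ∈ M' i ↔ e ∈ M (i ^^ τ v)) := by
    intro i e v hv
    simp only [M', Finset.mem_filter, Finset.mem_univ, true_and]
    refine ⟨fun ⟨u, hu, he⟩ => ?_, fun he => ⟨v, hv, he⟩⟩
    rwa [show τ v = τ u from congrArg ε (hMH _ e he v hv u hu)]
  have hends : ∀ e, ∃ v, v ∈ G.ends e := fun e => ⟨_, Sym2.out_fst_mem (G.ends e)⟩
  have hS' : ∀ i v, v ∈ recolor S τ i ↔ ∃ e ∈ M' i, v ∈ G.ends e := by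
    intro i v
    rw [mem_recolor, hS]
    exact exists_congr fun e => and_congr_left fun hv => (hM' i e v hv).symm
  have hM'm : ∀ i v, ∀ e ∈ M' i, ∀ e' ∈ M' i, v ∈ G.ends e → v ∈ G.ends e' → e = e' :=
    fun i v e he e' he' hv hv' =>
      hM _ v e ((hM' i e v hv).1 he) e' ((hM' i e' v hv').1 he') hv hv'
  have hM'disj : ∀ i j e, e ∈ M' i → e ∈ M' j → i = j := by
    intro i j e hi hj
    obtain ⟨v, hv⟩ := hends e
    have := hMdisj _ _ e ((hM' i e v hv).1 hi) ((hM' j e v hv).1 hj)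
    exact (Bool.xor_left_inj).1 this
  have hB'card : ∀ i, (B' i).card + (recolor R τ i).card = Fintype.card V := fun i =>
    card_add_card_of_heads (hB' i).head_notMem (hB' i).exists_head (hB' i).head_inj
  have hBcard : ∀ i, (B i).card + (R i).card = Fintype.card V := fun i =>
    card_add_card_of_heads (fun a ha hc => (hR i _).1 hc a ha rfl) (hRex i)
      fun a ha b hb hab => Sum.inr_injective
        ((hF i).2 (G.head a) _ ((hBF i a).1 ha) _ ((hBF i b).1 hb) rfl hab)
  -- both pairs of branchings have as many arcs as the in-degrees demand
  have hB'union : B' false ∪ B' true = D := by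
    refine Finset.eq_of_subset_of_card_le (Finset.union_subset (hB'D _) (hB'D _)) ?_
    rw [Finset.card_union_of_disjoint (hB'disj _ _ (by simp))]
    have h1 := Finset.card_union_le (B false) (B true)
    have h2 := card_recolor_add_card_recolor R τ
    have h3 := hBcard false
    have h4 := hBcard true
    have h5 := hB'card false
    have h6 := hB'card true
    change (B false ∪ B true).card ≤ _
    omega
  let F' : Bool → Set (E ⊕ A) := fun i => {x | Sum.elim (· ∈ M' i) (· ∈ B' i) x}
  have hedge : ∀ i, (edgePart (F' i)).ncard = (M' i).card := fun i =>
    Set.ncard_coe_finset (M' i)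
  have harc : ∀ i, (arcPart (F' i)).ncard = (B' i).card := fun i =>
    Set.ncard_coe_finset (B' i)
  refine ⟨F', ?_, ?_, ?_, ?_⟩
  · intro i
    have hcov : ∀ v, ∀ x ∈ F' i, ∀ y ∈ F' i, G.Covers x v → G.Covers y v → x = y := by
      have hmixed : ∀ e ∈ M' i, ∀ a ∈ B' i, G.head a ∉ G.ends e := by
        intro e he a ha hv
        refine (hB' i).head_notMem a ha (mem_recolor.2 (hSR _ (mem_recolor.1 ?_)))
        exact (hS' i _).2 ⟨e, he, hv⟩
      rintro v (e | a) hx (e' | a') hy hxv hyv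
      · exact congrArg _ (hM'm i v e hx e' hy hxv hyv)
      · exact absurd ((show v = G.head a' from hyv) ▸ hxv) (hmixed e hx a' hy)
      · exact absurd ((show v = G.head a from hxv) ▸ hyv) (hmixed e' hy a hx)
      · exact congrArg _ ((hB' i).head_inj a hx a' hy
          ((show v = G.head a from hxv).symm.trans hyv))
    obtain ⟨ρ, hρ⟩ := (hB' i).exists_rank
    exact ⟨G.not_hasCycle_of_rank hcov ρ fun a ha => hρ a ha, hcov⟩
  · rintro i j (e | a) hi hj
    · exact hM'disj i j e hi hj
    · by_contra hij
      exact Finset.disjoint_left.1 (hB'disj i j hij) hi hj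
  · rintro (e | a)
    · obtain ⟨v, hv⟩ := hends e
      constructor
      · rintro ⟨i, hi⟩
        exact ⟨i ^^ τ v, (hMF _ e).1 ((hM' i e v hv).1 hi)⟩
      · rintro ⟨i, hi⟩
        refine ⟨i ^^ τ v, (hM' _ e v hv).2 ?_⟩
        rw [Bool.xor_assoc, Bool.xor_self, Bool.xor_false]
        exact (hMF i e).2 hi
    · have h1 : (∃ i, a ∈ B' i) ↔ ∃ i, a ∈ B i := by
        rw [Bool.exists_bool, Bool.exists_bool, ← Finset.mem_union, ← Finset.mem_union, hB'union]
      exact h1.trans (exists_congr fun i => hBF i a)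
  · have hMdiff : ((M' false).card : ℤ) - (M' true).card =
        ∑ C, boolSign (ε C) * m C := by
      have h1 := card_recolor_sub_card_recolor S comp ε
      have h2 := G.card_covered_eq_two_mul (M' false) (hM'm false) (hS' false)
      have h3 := G.card_covered_eq_two_mul (M' true) (hM'm true) (hS' true)
      change ((recolor S τ false).card : ℤ) - (recolor S τ true).card = _ at h1
      rw [h2, h3, Finset.sum_congr rfl fun C _ => by rw [hm C, mul_left_comm],
        ← Finset.mul_sum] at h1
      push_cast at h1
      omega
    have hBdiff : ((B' false).card : ℤ) - (B' true).card =
        ∑ C, boolSign (ε C) * (m C - r C) - ∑ C, boolSign (ε C) * m C := by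
      have h1 := card_recolor_sub_card_recolor R comp ε
      change ((recolor R τ false).card : ℤ) - (recolor R τ true).card =
        ∑ C, boolSign (ε C) * r C at h1
      have h2 := hB'card false
      have h3 := hB'card true
      simp only [mul_sub, Finset.sum_sub_distrib]
      omega
    rw [ncard_eq_edgePart_add_arcPart, ncard_eq_edgePart_add_arcPart (F' true), hedge, hedge,
      harc, harc]
    refine ⟨?_, by rwa [hMdiff], by rwa [hBdiff]⟩
    have : ((M' false).card + (B' false).card : ℤ) - ((M' true).card + (B' true).card) =
        ∑ C, boolSign (ε C) * (m C - r C) := by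
      linarith
    push_cast
    rwa [this]

end MixedGraph

/-! ### Partitions into many matching forests -/

/-- A weighted sum of squares of sizes that decreases whenever an unbalanced pair of parts is
replaced by a balanced pair with the same union. -/
noncomputable def imbalance {E A : Type*} (F : Set (E ⊕ A)) : ℕ :=
  2 * F.ncard ^ 2 + (edgePart F).ncard ^ 2 + (arcPart F).ncard ^ 2

/-- Here `m` and `b` are the differences of the edge and arc numbers of two parts. The form is at
most `8` on balanced pairs of differences, and larger on all others. -/
lemma quadraticForm_lt {m b m' b' : ℤ} (h : ¬ (|m + b| ≤ 1 ∧ |m| ≤ 2 ∧ |b| ≤ 2))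
    (hf' : |m' + b'| ≤ 1) (hm' : |m'| ≤ 2) (hb' : |b'| ≤ 2) :
    2 * (m' + b') ^ 2 + m' ^ 2 + b' ^ 2 < 2 * (m + b) ^ 2 + m ^ 2 + b ^ 2 := by
  have h8 : 2 * (m' + b') ^ 2 + m' ^ 2 + b' ^ 2 ≤ 8 := by
    rw [abs_le] at hf' hm' hb'
    obtain ⟨h1, h2⟩ := hm'
    obtain ⟨h3, h4⟩ := hb'
    interval_cases m' <;> interval_cases b' <;> simp at hf' ⊢
  refine h8.trans_lt ?_
  by_cases h1 : |m + b| ≤ 1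
  · by_cases h2 : |m| ≤ 2
    · have h3 : 3 ≤ |b| := by
        by_contra hc
        exact h ⟨h1, h2, by omega⟩
      have : 3 ^ 2 ≤ |b| ^ 2 := by gcongr
      rw [sq_abs] at this
      nlinarith [sq_nonneg (m + b), sq_nonneg m]
    · have : 3 ^ 2 ≤ |m| ^ 2 := by
        have : 3 ≤ |m| := by omega
        gcongr
      rw [sq_abs] at this
      nlinarith [sq_nonneg (m + b), sq_nonneg b]
  · have : 2 ^ 2 ≤ |m + b| ^ 2 := by
      have : 2 ≤ |m + b| := by omega
      gcongr
    rw [sq_abs] at this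
    nlinarith [sq_nonneg (m - b)]

lemma imbalance_add_lt {E A : Type*} [Finite E] [Finite A] {F F' : Bool → Set (E ⊕ A)}
    (hF : ∀ i j x, x ∈ F i → x ∈ F j → i = j) (hF' : ∀ i j x, x ∈ F' i → x ∈ F' j → i = j)
    (hunion : ∀ x, (∃ i, x ∈ F' i) ↔ ∃ i, x ∈ F i)
    (h : ¬ (|((F false).ncard : ℤ) - (F true).ncard| ≤ 1 ∧
      |((edgePart (F false)).ncard : ℤ) - (edgePart (F true)).ncard| ≤ 2 ∧
      |((arcPart (F false)).ncard : ℤ) - (arcPart (F true)).ncard| ≤ 2))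
    (h1 : |((F' false).ncard : ℤ) - (F' true).ncard| ≤ 1)
    (h2 : |((edgePart (F' false)).ncard : ℤ) - (edgePart (F' true)).ncard| ≤ 2)
    (h3 : |((arcPart (F' false)).ncard : ℤ) - (arcPart (F' true)).ncard| ≤ 2) :
    imbalance (F' false) + imbalance (F' true) < imbalance (F false) + imbalance (F true) := by
  have hedge : (edgePart (F' false)).ncard + (edgePart (F' true)).ncard =
      (edgePart (F false)).ncard + (edgePart (F true)).ncard := by
    rw [← Set.ncard_union_eq, ← Set.ncard_union_eq]
    · congr 1
      ext e
      have := hunion (Sum.inl e)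
      rwa [Bool.exists_bool, Bool.exists_bool] at this
    · exact Set.disjoint_left.2 fun e he he' => Bool.false_ne_true (hF _ _ (Sum.inl e) he he')
    · exact Set.disjoint_left.2 fun e he he' => Bool.false_ne_true (hF' _ _ (Sum.inl e) he he')
  have harc : (arcPart (F' false)).ncard + (arcPart (F' true)).ncard =
      (arcPart (F false)).ncard + (arcPart (F true)).ncard := by
    rw [← Set.ncard_union_eq, ← Set.ncard_union_eq]
    · congr 1
      ext a
      have := hunion (Sum.inr a)
      rwa [Bool.exists_bool, Bool.exists_bool] at this
    · exact Set.disjoint_left.2 fun a ha ha' => Bool.false_ne_true (hF _ _ (Sum.inr a) ha ha')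
    · exact Set.disjoint_left.2 fun a ha ha' => Bool.false_ne_true (hF' _ _ (Sum.inr a) ha ha')
  simp only [imbalance, ncard_eq_edgePart_add_arcPart] at *
  generalize (edgePart (F false)).ncard = m₁ at *
  generalize (edgePart (F true)).ncard = m₂ at *
  generalize (arcPart (F false)).ncard = b₁ at *
  generalize (arcPart (F true)).ncard = b₂ at *
  generalize (edgePart (F' false)).ncard = m₁' at *
  generalize (edgePart (F' true)).ncard = m₂' at *
  generalize (arcPart (F' false)).ncard = b₁' at *
  generalize (arcPart (F' true)).ncard = b₂' at *
  push_cast at h h1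
  have key := quadraticForm_lt (m := m₁ - m₂) (b := b₁ - b₂) (m' := m₁' - m₂') (b' := b₁' - b₂')
    (by rwa [sub_add_sub_comm]) (by rwa [sub_add_sub_comm]) h2 h3
  zify at hedge harc ⊢
  -- `2 * (x ^ 2 + y ^ 2) = (x + y) ^ 2 + (x - y) ^ 2`, where the sums are the same before and after
  have e1 : (m₁' + m₂' : ℤ) ^ 2 = (m₁ + m₂) ^ 2 := by rw [hedge]
  have e2 : (b₁' + b₂' : ℤ) ^ 2 = (b₁ + b₂) ^ 2 := by rw [harc]
  have e3 : (m₁' + m₂' + (b₁' + b₂') : ℤ) ^ 2 = (m₁ + m₂ + (b₁ + b₂)) ^ 2 := by rw [hedge, harc]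
  linarith

/-- Two members of a partition may be replaced by two matching forests with the same union. -/
lemma MixedGraph.IsMatchingForestPartition.exists_replace_pair {V E A : Type*}
    {G : MixedGraph V E A} {k : ℕ} {F : Fin k → Set (E ⊕ A)} (hF : G.IsMatchingForestPartition F)
    {i j : Fin k} (hij : i ≠ j) {P : Bool → Set (E ⊕ A)} (hP : ∀ b, G.IsMatchingForest (P b))
    (hdisj : ∀ b c x, x ∈ P b → x ∈ P c → b = c)
    (hunion : ∀ x, (∃ b, x ∈ P b) ↔ x ∈ F i ∨ x ∈ F j) :
    ∃ F' : Fin k → Set (E ⊕ A), G.IsMatchingForestPartition F' ∧ F' i = P false ∧ F' j = P true ∧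
      ∀ l, l ≠ i → l ≠ j → F' l = F l := by
  have huniqF : ∀ l l' x, x ∈ F l → x ∈ F l' → l = l' := fun l l' x hl hl' =>
    (hF.2 x).unique hl hl'
  obtain ⟨F', hi, hj, hl⟩ : ∃ F' : Fin k → Set (E ⊕ A), F' i = P false ∧ F' j = P true ∧
      ∀ l, l ≠ i → l ≠ j → F' l = F l :=
    ⟨fun l => if l = i then P false else if l = j then P true else F l, if_pos rfl,
      by simp [hij.symm], fun l h1 h2 => by simp [h1, h2]⟩
  refine ⟨F', ⟨fun l => ?_, fun x => ?_⟩, hi, hj, hl⟩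
  · by_cases hli : l = i
    · rw [hli, hi]; exact hP _
    · by_cases hlj : l = j
      · rw [hlj, hj]; exact hP _
      · rw [hl l hli hlj]; exact hF.1 l
  · have hcases : ∀ l, x ∈ F' l →
        (l = i ∧ x ∈ P false) ∨ (l = j ∧ x ∈ P true) ∨ (l ≠ i ∧ l ≠ j ∧ x ∈ F l) := by
      intro l hx
      by_cases hli : l = i
      · rw [hli, hi] at hx
        exact Or.inl ⟨hli, hx⟩
      · by_cases hlj : l = j
        · rw [hlj, hj] at hx
          exact Or.inr (Or.inl ⟨hlj, hx⟩)
        · rw [hl l hli hlj] at hx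
          exact Or.inr (Or.inr ⟨hli, hlj, hx⟩)
    have hnot : ∀ b l, x ∈ P b → l ≠ i → l ≠ j → x ∉ F l := by
      intro b l hb hli hlj hxl
      rcases (hunion x).1 ⟨b, hb⟩ with hx | hx
      · exact hli (huniqF _ _ x hxl hx)
      · exact hlj (huniqF _ _ x hxl hx)
    refine existsUnique_of_exists_of_unique ?_ fun l l' hxl hxl' => ?_
    · by_cases hx : ∃ b, x ∈ P b
      · obtain ⟨b, hb⟩ := hx
        cases b
        · exact ⟨i, by rwa [hi]⟩
        · exact ⟨j, by rwa [hj]⟩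
      · obtain ⟨l, hxl, -⟩ := hF.2 x
        rw [hunion, not_or] at hx
        refine ⟨l, ?_⟩
        rwa [hl l (fun hc => hx.1 (by rwa [← hc])) (fun hc => hx.2 (by rwa [← hc]))]
    · rcases hcases l hxl with ⟨h1, h2⟩ | ⟨h1, h2⟩ | ⟨h1, h2, h3⟩ <;>
        rcases hcases l' hxl' with ⟨h1', h2'⟩ | ⟨h1', h2'⟩ | ⟨h1', h2', h3'⟩
      · rw [h1, h1']
      · exact absurd (hdisj _ _ x h2 h2') (by decide)
      · exact absurd h3' (hnot _ l' h2 h1' h2')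
      · exact absurd (hdisj _ _ x h2 h2') (by decide)
      · rw [h1, h1']
      · exact absurd h3' (hnot _ l' h2 h1' h2')
      · exact absurd h3 (hnot _ l h2' h1 h2)
      · exact absurd h3 (hnot _ l h2' h1 h2)
      · exact huniqF _ _ x h3 h3'

theorem theorem1 {V E A : Type*} [Finite V] [Finite E] [Finite A]
    (G : MixedGraph V E A) (k : ℕ)
    (h : ∃ F : Fin k → Set (E ⊕ A), G.IsMatchingForestPartition F) :
    ∃ F : Fin k → Set (E ⊕ A), G.IsMatchingForestPartition F ∧
      ∀ i j : Fin k,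
        |((F i).ncard : ℤ) - ((F j).ncard : ℤ)| ≤ 1 ∧
        |((edgePart (F i)).ncard : ℤ) - ((edgePart (F j)).ncard : ℤ)| ≤ 2 ∧
        |((arcPart (F i)).ncard : ℤ) - ((arcPart (F j)).ncard : ℤ)| ≤ 2 := by
  obtain ⟨F, hF, hmin⟩ := Set.exists_min_image {F : Fin k → Set (E ⊕ A) |
    G.IsMatchingForestPartition F} (fun F => ∑ i, imbalance (F i)) (Set.toFinite _) h
  refine ⟨F, hF, fun i j => ?_⟩
  by_contra hij
  have hne : i ≠ j := by
    rintro rfl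
    simp at hij
  obtain ⟨P, hPi, hPj⟩ : ∃ P : Bool → Set (E ⊕ A), P false = F i ∧ P true = F j :=
    ⟨fun b => bif b then F j else F i, rfl, rfl⟩
  have hPF : ∀ b, G.IsMatchingForest (P b) := by
    rintro (_ | _)
    · exact hPi ▸ hF.1 i
    · exact hPj ▸ hF.1 j
  have hP : ∀ b c x, x ∈ P b → x ∈ P c → b = c := by
    have hx : ∀ x, x ∈ P false → x ∉ P true := fun x h1 h2 => by
      rw [hPi] at h1
      rw [hPj] at h2
      exact hne ((hF.2 x).unique h1 h2)
    rintro (_ | _) (_ | _) x hb hc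
    · rfl
    · exact absurd hc (hx x hb)
    · exact absurd hb (hx x hc)
    · rfl
  obtain ⟨P', hP'F, hP'disj, hP'union, h1, h2, h3⟩ := G.exists_balanced_repartition hPF hP
  rw [← hPi, ← hPj] at hij
  have hlt := imbalance_add_lt hP hP'disj hP'union hij h1 h2 h3
  rw [hPi, hPj] at hlt
  obtain ⟨F', hF', hi, hj, hl⟩ := hF.exists_replace_pair hne hP'F hP'disj fun x => by
    rw [hP'union, Bool.exists_bool, hPi, hPj]
  have hsum : ∀ F : Fin k → Set (E ⊕ A), ∑ l, imbalance (F l) =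
      imbalance (F i) + imbalance (F j) +
        ∑ l ∈ (Finset.univ.erase i).erase j, imbalance (F l) := by
    intro F
    rw [← Finset.add_sum_erase _ _ (Finset.mem_univ i),
      ← Finset.add_sum_erase _ _ (Finset.mem_erase.2 ⟨hne.symm, Finset.mem_univ j⟩), add_assoc]
  have hrest : ∑ l ∈ (Finset.univ.erase i).erase j, imbalance (F' l) =
      ∑ l ∈ (Finset.univ.erase i).erase j, imbalance (F l) :=
    Finset.sum_congr rfl fun l hmem => by
      rw [hl l (Finset.ne_of_mem_erase (Finset.mem_of_mem_erase hmem))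
        (Finset.ne_of_mem_erase hmem)]
  have hle : ∑ l, imbalance (F l) ≤ ∑ l, imbalance (F' l) := hmin F' hF'
  rw [hsum F, hsum F', hi, hj, hrest] at hle
  omega
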